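/- Let $(\varepsilon_i)_{i\ge 0}$ be independent and identically distributed real random variables on a probability space, with mean $0$, variance $\sigma^2$ where $\sigma>0$, and finite fourth moment, and put $\gamma_4=\mathrm{E}(\varepsilon_0^4)/\sigma^4$. Let $g:[0,1]\to\mathbb{R}$ be twice differentiable with bounded second derivative, and for each $n$ let $y_i=g(i/n)+\varepsilon_i$ for $i=1,\dots,n$. Let $0<r<3/4$ and let $k=k(n)$ be any integer rounding of $n^r$, that is, $k(n)$ is a nonnegative integer with $|k(n)-n^r|<1$. Then the lag-$k$ Rice estimator $$s_k=\frac{1}{2(n-k)}\sum_{i=1}^{n-k}(y_{i+k}-y_i)^2$$ satisfies $$\sqrt{n}\,(s_k-\sigma^2)\to N(0,\gamma_4\sigma^4)\quad\text{in distribution as } n\to\infty .$$ -/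

import Mathlib

open MeasureTheory ProbabilityTheory Filter

noncomputable section

/-- `g` is twice differentiable on `[0, 1]` (one-sided at the endpoints) and its second derivative
is bounded there. -/
def HasBoundedSecondDeriv (g : ℝ → ℝ) : Prop :=
  ∃ (g' g'' : ℝ → ℝ) (C : ℝ), ∀ x ∈ Set.Icc (0 : ℝ) 1,
    HasDerivWithinAt g (g' x) (Set.Icc 0 1) x ∧
    HasDerivWithinAt g' (g'' x) (Set.Icc 0 1) x ∧
    |g'' x| ≤ C

/-- The observation `y_i = g (i / n) + ε_i` (used for `1 ≤ i ≤ n`) on the equally spaced design. -/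
def observation {Ω : Type*} (g : ℝ → ℝ) (ε : ℕ → Ω → ℝ) (n i : ℕ) (ω : Ω) : ℝ :=
  g ((i : ℝ) / (n : ℝ)) + ε i ω

/-- The lag-`k` Rice estimator `(1 / (2 (n - k))) ∑_{i=1}^{n-k} (y_{i+k} - y_i)²` of the data
`y_1, …, y_n`. -/
def lagRice (n k : ℕ) (y : ℕ → ℝ) : ℝ :=
  1 / (2 * ((n : ℝ) - (k : ℝ))) * ∑ i ∈ Finset.Icc 1 (n - k), (y (i + k) - y i) ^ 2

/-- The standardized `j`-th moment `γ_j = E (X ^ j) / σ ^ j`. -/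
def stdMoment {Ω : Type*} [MeasurableSpace Ω] (X : Ω → ℝ) (σ : ℝ) (P : Measure Ω) (j : ℕ) : ℝ :=
  (∫ ω, X ω ^ j ∂P) / σ ^ j

end

/-!
Write `ξ i = ε (i + 1)`, `N = n - k` and `G i = g ((i + 1) / n)`. Squaring the differences of the data
gives (`lagRice_sub_sq`)

  `s_k - σ² = (1 / N) ∑_{i < N} X_i + boundary terms + cross terms + bias`,
  `X_i = ξ_{i+k}² - σ² - ξ_{i+k} ξ_i`.

The boundary terms contain only `2 k` of the centred squares `ξ_i² - σ²`. The cross terms are weighted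
sums of the noise with weights `G (i + k) - G i = O(k / n)`, because `g` is Lipschitz on `[0, 1]`.
Multiplied by `√n`, both have variance tending to zero since `k / n → 0`, and Chebyshev's inequality
applies (`tendstoInMeasure_weighted_sum`). The bias is `O((k / n)²)`, and `√n (k / n)² → 0` is
what `r < 3 / 4` is for, everything else needing only `r < 1` (`tendsto_sqrt_mul_div_sq`).

It remains to prove a central limit theorem for `∑ X_i`, with limiting variance `E X_i² = E ε⁴`
(`IsIIDNoise.tendstoInDistribution_lagSum`). The `X_i` are martingale differences, and the
characteristic functions `a_m = E exp (i s S_m)` of the partial sums satisfy `a_{m+1} ≈ q a_m` with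
`q = exp (-s² E ε⁴ / 2)` (`IsIIDNoise.norm_integral_exp_lagSum_succ_sub_le`). Apart from the Taylor
remainder of the exponential, the error comes from the conditional variance of `X_m` given the past,
which is `E ε⁴` plus a centred function of `ξ_m`. That function is nearly uncorrelated with
`exp (i s S_m)`, because `ξ_m` occurs in only one summand of `S_m`, namely `X_{m-k}`. As
this leaves a factor `|s|`, the error per step is `o(s²)`; it is summed over `N` steps with `N s²`
bounded, and Lévy's theorem concludes.
-/

open scoped Topology

/-! ### Taylor remainder of the characters -/

/-- The error `exp (x i) - (1 + x i - x² / 2)` of the second order Taylor polynomial of the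
characters of `ℝ`. -/
noncomputable def expRemainder (x : ℝ) : ℂ :=
  Complex.exp (x * Complex.I) - (1 + x * Complex.I - (x : ℂ) ^ 2 / 2)

lemma continuous_expRemainder : Continuous expRemainder := by
  unfold expRemainder
  fun_prop

lemma norm_expRemainder_le_cube {x : ℝ} (hx : |x| ≤ 1) : ‖expRemainder x‖ ≤ |x| ^ 3 := by
  have hn : ‖(x : ℂ) * Complex.I‖ = |x| := by simp
  have h := Complex.exp_bound (x := (x : ℂ) * Complex.I) (by rw [hn]; exact hx)
    (n := 3) (by norm_num)
  rw [hn] at h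
  have e : Complex.exp (x * Complex.I)
      - ∑ m ∈ Finset.range 3, ((x : ℂ) * Complex.I) ^ m / m.factorial = expRemainder x := by
    simp only [Finset.sum_range_succ, Finset.sum_range_zero, expRemainder, mul_pow, Complex.I_sq,
      Nat.factorial]
    push_cast
    ring
  rw [e] at h
  refine h.trans (mul_le_of_le_one_right (by positivity) ?_)
  norm_num [Nat.factorial]

lemma norm_expRemainder_le_sq (x : ℝ) : ‖expRemainder x‖ ≤ 4 * x ^ 2 := by
  rw [← sq_abs x]
  have h0 := abs_nonneg x
  rcases le_total |x| 1 with hx | hx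
  · refine (norm_expRemainder_le_cube hx).trans ?_
    nlinarith [sq_nonneg |x|, mul_nonneg (sq_nonneg |x|) (sub_nonneg.2 hx)]
  · have h1 : ‖expRemainder x‖ ≤ 1 + (1 + |x| + |x| ^ 2 / 2) := by
      refine (norm_sub_le _ _).trans (add_le_add ?_ ((norm_sub_le _ _).trans
        (add_le_add ((norm_add_le _ _).trans ?_) ?_)))
      · rw [Complex.norm_exp_ofReal_mul_I]
      · simp
      · simp
    nlinarith

/-- The Lindeberg-type estimate: for a square integrable `W`, the expected Taylor remainder of
`exp (i s W)` is of smaller order than `s²`. -/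
lemma tendsto_integral_norm_expRemainder_div_sq {Ω : Type*} [MeasurableSpace Ω] {P : Measure Ω}
    {W : Ω → ℝ} (hW : MemLp W 2 P) {s : ℕ → ℝ} (hs : Tendsto s atTop (𝓝 0)) :
    Tendsto (fun n ↦ (∫ ω, ‖expRemainder (s n * W ω)‖ ∂P) / s n ^ 2) atTop (𝓝 0) := by
  have hbound : ∀ n ω, ‖expRemainder (s n * W ω)‖ / s n ^ 2 ≤ 4 * W ω ^ 2 := fun n ω ↦ by
    refine div_le_of_le_mul₀ (sq_nonneg _) (by positivity) ?_
    exact (norm_expRemainder_le_sq _).trans_eq (by ring)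
  have key : Tendsto (fun n ↦ ∫ ω, ‖expRemainder (s n * W ω)‖ / s n ^ 2 ∂P) atTop
      (𝓝 (∫ _, (0 : ℝ) ∂P)) := by
    refine tendsto_integral_of_dominated_convergence (fun ω ↦ 4 * W ω ^ 2) (fun n ↦ ?_)
      (hW.integrable_sq.const_mul 4) (fun n ↦ ae_of_all _ fun ω ↦ ?_) (ae_of_all _ fun ω ↦ ?_)
    · have := continuous_expRemainder.comp_aestronglyMeasurable
        (hW.aestronglyMeasurable.const_mul (s n))
      simpa only [div_eq_mul_inv] using this.norm.mul_const _
    · rw [Real.norm_of_nonneg (by positivity)]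
      exact hbound n ω
    · have h0 : Tendsto (fun n ↦ |s n * W ω|) atTop (𝓝 0) := by
        simpa using (hs.mul_const (W ω)).abs
      have h1 : Tendsto (fun n ↦ |s n| * |W ω| ^ 3) atTop (𝓝 0) := by
        simpa using hs.abs.mul_const (|W ω| ^ 3)
      refine squeeze_zero' (Eventually.of_forall fun n ↦ by positivity) ?_ h1
      filter_upwards [h0.eventually_le_const one_pos] with n hn
      refine div_le_of_le_mul₀ (sq_nonneg _) (by positivity) ?_
      refine (norm_expRemainder_le_cube hn).trans_eq ?_
      rw [abs_mul, ← sq_abs (s n)]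
      ring
  simpa [integral_div] using key

/-! ### Independence and moments of one increment -/

section Independence

variable {Ω : Type*} [MeasurableSpace Ω] {P : Measure Ω}

/-- Measurable functions of a sequence of independent variables are independent if they depend on
disjoint finite sets of coordinates. -/
lemma ProbabilityTheory.iIndepFun.indepFun_of_dependsOn {ι : Type*} [DecidableEq ι] {ε : ι → Ω → ℝ}
    (hindep : iIndepFun ε P) (hmeas : ∀ i, AEMeasurable (ε i) P) {α β : Type*}
    [MeasurableSpace α] [MeasurableSpace β] {f : (ι → ℝ) → α} {g : (ι → ℝ) → β}
    (hf : Measurable f) (hg : Measurable g) {s t : Finset ι} (hst : Disjoint s t)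
    (hfs : DependsOn f (s : Set ι)) (hgt : DependsOn g (t : Set ι)) :
    IndepFun (fun ω ↦ f (fun i ↦ ε i ω)) (fun ω ↦ g (fun i ↦ ε i ω)) P := by
  -- a tuple indexed by `u` is extended by zero to a point of `ι → ℝ`
  let E (u : Finset ι) (x : u → ℝ) (i : ι) : ℝ := if h : i ∈ u then x ⟨i, h⟩ else 0
  have hE : ∀ u, Measurable (E u) := fun u ↦ by
    refine measurable_pi_iff.2 fun i ↦ ?_
    by_cases h : i ∈ u
    · simpa only [E, h, dite_true] using measurable_pi_apply _
    · simp only [E, h, dite_false, measurable_const]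
  have h := (hindep.indepFun_finset₀ s t hst hmeas).comp (hf.comp (hE s)) (hg.comp (hE t))
  convert h using 1
  · ext ω
    exact hfs fun i hi ↦ by simp [E, Finset.mem_coe.1 hi]
  · ext ω
    exact hgt fun i hi ↦ by simp [E, Finset.mem_coe.1 hi]

lemma integrable_bounded_mul {U : Ω → ℂ} {f : Ω → ℝ} (hU : AEStronglyMeasurable U P)
    (hU1 : ∀ ω, ‖U ω‖ ≤ 1) (hf : Integrable f P) : Integrable (fun ω ↦ U ω * (f ω : ℂ)) P :=
  hf.ofReal.bdd_mul hU (c := 1) (ae_of_all _ hU1)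

lemma ProbabilityTheory.IndepFun.integrable_and_integral_mul_ofReal
    {U : Ω → ℂ} {a b : Ω → ℝ} (hUba : IndepFun (fun ω ↦ (U ω, b ω)) a P) {φ : ℂ × ℝ → ℂ}
    {ψ : ℝ → ℝ} (hφ : Measurable φ) (hψ : Measurable ψ) (hφi : Integrable (fun ω ↦ φ (U ω, b ω)) P)
    (hψi : Integrable (fun ω ↦ ψ (a ω)) P) :
    Integrable (fun ω ↦ φ (U ω, b ω) * (ψ (a ω) : ℂ)) P ∧
    ∫ ω, φ (U ω, b ω) * (ψ (a ω) : ℂ) ∂P =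
      (∫ ω, φ (U ω, b ω) ∂P) * ((∫ ω, ψ (a ω) ∂P : ℝ) : ℂ) := by
  have h : IndepFun (fun ω ↦ φ (U ω, b ω)) (fun ω ↦ (ψ (a ω) : ℂ)) P :=
    hUba.comp (φ := φ) (ψ := fun x ↦ (ψ x : ℂ)) hφ (Complex.measurable_ofReal.comp hψ)
  refine ⟨h.integrable_mul hφi hψi.ofReal, ?_⟩
  rw [h.integral_fun_mul_eq_mul_integral hφi.aestronglyMeasurable hψi.ofReal.aestronglyMeasurable,
    integral_complex_ofReal]

variable [IsProbabilityMeasure P] {U : Ω → ℂ} {a b : Ω → ℝ} {σ : ℝ}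

lemma memLp_sq_sub (ha : MemLp a 4 P) : MemLp (fun ω ↦ a ω ^ 2 - σ ^ 2) 2 P := by
  have h : MemLp (fun ω ↦ a ω ^ 2) 2 P := by
    refine (memLp_two_iff_integrable_sq (ha.aestronglyMeasurable.pow 2)).2 ?_
    refine (ha.integrable_norm_pow (p := 4) (by norm_num)).congr (ae_of_all _ fun ω ↦ ?_)
    simp only [Real.norm_eq_abs, Pi.pow_apply]
    rw [← pow_mul, ← abs_pow, abs_of_nonneg (by positivity)]
  exact h.sub (memLp_const _)

lemma integrable_sq_sub_mul_self (ha : MemLp a 4 P) :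
    Integrable (fun ω ↦ (a ω ^ 2 - σ ^ 2) * a ω) P :=
  (memLp_sq_sub ha).integrable_mul (ha.mono_exponent (p := 2) (by norm_num))

/-- If `a` is independent of the past, represented by `(U, b)`, then `a² - σ² - a b` is a
martingale difference. -/
lemma integral_mul_lag_eq_zero (hU : AEStronglyMeasurable U P) (hU1 : ∀ ω, ‖U ω‖ ≤ 1)
    (hUba : IndepFun (fun ω ↦ (U ω, b ω)) a P) (ha : MemLp a 4 P) (hb : MemLp b 2 P)
    (ha1 : ∫ ω, a ω ∂P = 0) (ha2 : ∫ ω, a ω ^ 2 ∂P = σ ^ 2) :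
    ∫ ω, U ω * ((a ω ^ 2 - σ ^ 2 - a ω * b ω : ℝ) : ℂ) ∂P = 0 := by
  have ha' : MemLp a 2 P := ha.mono_exponent (by norm_num)
  have h0 : ∫ ω, (a ω ^ 2 - σ ^ 2) ∂P = 0 := by
    rw [integral_sub ha'.integrable_sq (integrable_const _), ha2]
    simp
  obtain ⟨i1, e1⟩ := hUba.integrable_and_integral_mul_ofReal (φ := fun p ↦ p.1)
    (ψ := fun x ↦ x ^ 2 - σ ^ 2) (by fun_prop) (by fun_prop)
    (by simpa using integrable_bounded_mul hU hU1 (integrable_const (1 : ℝ)))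
    ((memLp_sq_sub ha).integrable (by norm_num))
  obtain ⟨i2, e2⟩ := hUba.integrable_and_integral_mul_ofReal (φ := fun p ↦ p.1 * (p.2 : ℂ))
    (ψ := fun x ↦ x) (by fun_prop) (by fun_prop)
    (integrable_bounded_mul hU hU1 (hb.integrable (by norm_num))) (ha.integrable (by norm_num))
  have : ∀ ω, U ω * ((a ω ^ 2 - σ ^ 2 - a ω * b ω : ℝ) : ℂ) =
      U ω * ((a ω ^ 2 - σ ^ 2 : ℝ) : ℂ) - U ω * (b ω : ℂ) * (a ω : ℂ) := fun ω ↦ by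
    push_cast
    ring
  simp_rw [this]
  rw [integral_sub i1 i2, e1, e2, h0, ha1]
  simp

/-- The conditional variance of the increment `a² - σ² - a b` given the past is a quadratic
polynomial in `b`, here split into its mean `E a⁴` and a centred part. -/
lemma integral_mul_lag_sq (hU : AEStronglyMeasurable U P) (hU1 : ∀ ω, ‖U ω‖ ≤ 1)
    (hUba : IndepFun (fun ω ↦ (U ω, b ω)) a P) (ha : MemLp a 4 P) (hb : MemLp b 2 P)
    (ha2 : ∫ ω, a ω ^ 2 ∂P = σ ^ 2) :
    Integrable (fun ω ↦ U ω * (((a ω ^ 2 - σ ^ 2 - a ω * b ω) ^ 2 : ℝ) : ℂ)) P ∧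
    ∫ ω, U ω * (((a ω ^ 2 - σ ^ 2 - a ω * b ω) ^ 2 : ℝ) : ℂ) ∂P =
      ((∫ ω, a ω ^ 4 ∂P : ℝ) : ℂ) * ∫ ω, U ω ∂P +
      ∫ ω, U ω * ((σ ^ 2 * (b ω ^ 2 - σ ^ 2)
        - 2 * (∫ ω, (a ω ^ 2 - σ ^ 2) * a ω ∂P) * b ω : ℝ) : ℂ) ∂P := by
  have ha' : MemLp a 2 P := ha.mono_exponent (by norm_num)
  have hUi : Integrable U P := by
    simpa using integrable_bounded_mul hU hU1 (integrable_const (1 : ℝ))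
  have hUb := integrable_bounded_mul hU hU1 (hb.integrable (by norm_num))
  have hUb2 := integrable_bounded_mul hU hU1 hb.integrable_sq
  have hη := (memLp_sq_sub (σ := σ) ha).integrable_sq
  have h4 : ∫ ω, (a ω ^ 2 - σ ^ 2) ^ 2 ∂P = ∫ ω, a ω ^ 4 ∂P - σ ^ 4 := by
    have e : ∀ ω, a ω ^ 4 = (a ω ^ 2 - σ ^ 2) ^ 2 + (2 * σ ^ 2 * a ω ^ 2 - σ ^ 4) :=
      fun ω ↦ by ring
    have i : Integrable (fun ω ↦ 2 * σ ^ 2 * a ω ^ 2) P := ha'.integrable_sq.const_mul _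
    have i' : Integrable (fun ω ↦ 2 * σ ^ 2 * a ω ^ 2 - σ ^ 4) P := i.sub (integrable_const _)
    simp_rw [e]
    rw [integral_add hη i', integral_sub i (integrable_const _),
      integral_const_mul, ha2]
    simp
    ring
  obtain ⟨i1, e1⟩ := hUba.integrable_and_integral_mul_ofReal (φ := fun p ↦ p.1)
    (ψ := fun x ↦ (x ^ 2 - σ ^ 2) ^ 2) (by fun_prop) (by fun_prop) hUi hη
  obtain ⟨i2, e2⟩ := hUba.integrable_and_integral_mul_ofReal (φ := fun p ↦ p.1 * (p.2 : ℂ))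
    (ψ := fun x ↦ (x ^ 2 - σ ^ 2) * x) (by fun_prop) (by fun_prop) hUb
    (integrable_sq_sub_mul_self ha)
  obtain ⟨i3, e3⟩ := hUba.integrable_and_integral_mul_ofReal
    (φ := fun p ↦ p.1 * ((p.2 ^ 2 : ℝ) : ℂ))
    (ψ := fun x ↦ x ^ 2) (by fun_prop) (by fun_prop) hUb2 ha'.integrable_sq
  have hL : ∀ ω, U ω * (((a ω ^ 2 - σ ^ 2 - a ω * b ω) ^ 2 : ℝ) : ℂ) =
      U ω * (((a ω ^ 2 - σ ^ 2) ^ 2 : ℝ) : ℂ)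
      + U ω * ((b ω ^ 2 : ℝ) : ℂ) * ((a ω ^ 2 : ℝ) : ℂ)
      - 2 * (U ω * (b ω : ℂ) * (((a ω ^ 2 - σ ^ 2) * a ω : ℝ) : ℂ)) := fun ω ↦ by
    push_cast
    ring
  have hR : ∀ ω, U ω * ((σ ^ 2 * (b ω ^ 2 - σ ^ 2)
        - 2 * (∫ ω, (a ω ^ 2 - σ ^ 2) * a ω ∂P) * b ω : ℝ) : ℂ) =
      (σ : ℂ) ^ 2 * (U ω * ((b ω ^ 2 : ℝ) : ℂ)) - (σ : ℂ) ^ 4 * U ω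
      - 2 * ((∫ ω, (a ω ^ 2 - σ ^ 2) * a ω ∂P : ℝ) : ℂ) * (U ω * (b ω : ℂ)) := fun ω ↦ by
    push_cast
    ring
  simp_rw [hL, hR]
  dsimp only at i1 i2 i3 e1 e2 e3
  have i13 : Integrable (fun ω ↦ U ω * (((a ω ^ 2 - σ ^ 2) ^ 2 : ℝ) : ℂ)
      + U ω * ((b ω ^ 2 : ℝ) : ℂ) * ((a ω ^ 2 : ℝ) : ℂ)) P := i1.add i3
  have iR : Integrable (fun ω ↦ (σ : ℂ) ^ 2 * (U ω * ((b ω ^ 2 : ℝ) : ℂ)) - (σ : ℂ) ^ 4 * U ω) P :=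
    (hUb2.const_mul _).sub (hUi.const_mul _)
  refine ⟨i13.sub (i2.const_mul 2), ?_⟩
  rw [integral_sub i13 (i2.const_mul 2), integral_add i1 i3, integral_const_mul,
    integral_sub iR (hUb.const_mul _),
    integral_sub (hUb2.const_mul _) (hUi.const_mul _), integral_const_mul, integral_const_mul,
    integral_const_mul, e1, e2, e3, h4, ha2]
  push_cast
  ring

/-- A centred `h` that is independent of `S'` is almost uncorrelated with `exp (i s S)` when `S` is
a perturbation of `S'`. -/
lemma norm_integral_exp_mul_le {S S' h Z : Ω → ℝ} (hS : AEMeasurable S P)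
    (hS' : AEMeasurable S' P) (hZ : MemLp Z 2 P) (hh : MemLp h 2 P) (hindep : IndepFun S' h P)
    (hh0 : ∫ ω, h ω ∂P = 0) (hSZ : ∀ ω, |S ω - S' ω| ≤ |Z ω|) (s : ℝ) :
    ‖∫ ω, Complex.exp ((s * S ω : ℝ) * Complex.I) * (h ω : ℂ) ∂P‖ ≤
      |s| * ((∫ ω, Z ω ^ 2 ∂P + ∫ ω, h ω ^ 2 ∂P) / 2) := by
  have hm : ∀ {T : Ω → ℝ}, AEMeasurable T P →
      AEStronglyMeasurable (fun ω ↦ Complex.exp ((s * T ω : ℝ) * Complex.I)) P := fun hT ↦ by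
    exact (by fun_prop : AEMeasurable _ P).aestronglyMeasurable
  have hi : ∀ {T : Ω → ℝ}, AEMeasurable T P →
      Integrable (fun ω ↦ Complex.exp ((s * T ω : ℝ) * Complex.I) * (h ω : ℂ)) P := fun hT ↦
    integrable_bounded_mul (hm hT) (fun ω ↦ (Complex.norm_exp_ofReal_mul_I _).le)
      (hh.integrable (by norm_num))
  have h0 : ∫ ω, Complex.exp ((s * S' ω : ℝ) * Complex.I) * (h ω : ℂ) ∂P = 0 := by
    have := hindep.comp (φ := fun x : ℝ ↦ Complex.exp ((s * x : ℝ) * Complex.I))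
      (ψ := fun x : ℝ ↦ (x : ℂ)) (by fun_prop) (by fun_prop)
    have e := this.integral_fun_mul_eq_mul_integral (hm hS')
      (hh.integrable (by norm_num)).ofReal.aestronglyMeasurable
    simp only [Function.comp_apply] at e
    rw [e]
    have : ∫ ω, ((h ω : ℝ) : ℂ) ∂P = 0 := by rw [integral_complex_ofReal, hh0]; simp
    simp [this]
  rw [← sub_zero (∫ ω, _ ∂P), ← h0, ← integral_sub (hi hS) (hi hS')]
  rw [← integral_add hZ.integrable_sq hh.integrable_sq, ← integral_div, ← integral_const_mul]
  refine norm_integral_le_of_norm_le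
    (((hZ.integrable_sq.add hh.integrable_sq).div_const 2).const_mul _) (ae_of_all _ fun ω ↦ ?_)
  have hd : ‖Complex.exp ((s * S ω : ℝ) * Complex.I) - Complex.exp ((s * S' ω : ℝ) * Complex.I)‖
      ≤ |s| * |Z ω| := by
    have e : Complex.exp ((s * S ω : ℝ) * Complex.I) - Complex.exp ((s * S' ω : ℝ) * Complex.I) =
        Complex.exp ((s * S' ω : ℝ) * Complex.I) *
          (Complex.exp (Complex.I * ((s * S ω - s * S' ω : ℝ) : ℂ)) - 1) := by
      rw [mul_sub, ← Complex.exp_add, mul_one]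
      congr 2
      push_cast
      ring
    rw [e, norm_mul, Complex.norm_exp_ofReal_mul_I, one_mul]
    refine Real.norm_exp_I_mul_ofReal_sub_one_le.trans ?_
    rw [← mul_sub, norm_mul, Real.norm_eq_abs, Real.norm_eq_abs]
    exact mul_le_mul_of_nonneg_left (hSZ ω) (abs_nonneg _)
  rw [← sub_mul, norm_mul, Complex.norm_real, Real.norm_eq_abs]
  refine (mul_le_mul_of_nonneg_right hd (abs_nonneg _)).trans ?_
  rw [mul_assoc]
  refine mul_le_mul_of_nonneg_left ?_ (abs_nonneg _)
  rw [← sq_abs (Z ω), ← sq_abs (h ω)]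
  nlinarith [sq_nonneg (|Z ω| - |h ω|)]

end Independence

/-! ### The martingale part and the recursion it satisfies -/

/-- The summand `x_{i+k}² - σ² - x_{i+k} x_i`. When `x` is the noise, this is a martingale
difference sequence in `i`, and up to boundary terms half of `(x_{i+k} - x_i)² - 2σ²`. -/
def lagTerm (σ : ℝ) (k : ℕ) (x : ℕ → ℝ) (i : ℕ) : ℝ :=
  x (i + k) ^ 2 - σ ^ 2 - x (i + k) * x i

/-- The sum of the first `m` of the `lagTerm`s. -/
def lagSum (σ : ℝ) (k : ℕ) (x : ℕ → ℝ) (m : ℕ) : ℝ :=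
  ∑ i ∈ Finset.range m, lagTerm σ k x i

/-- Independent, identically distributed, centred random variables with second moment `σ²` and
finite fourth moment. -/
structure IsIIDNoise {Ω : Type*} [MeasurableSpace Ω] (ε : ℕ → Ω → ℝ) (σ : ℝ) (P : Measure Ω) :
    Prop where
  indep : iIndepFun ε P
  ident : ∀ i, IdentDistrib (ε i) (ε 0) P P
  mean : ∫ ω, ε 0 ω ∂P = 0
  sq : ∫ ω, ε 0 ω ^ 2 ∂P = σ ^ 2
  memLp : MemLp (ε 0) 4 P

@[fun_prop]
lemma measurable_lagTerm (σ : ℝ) (k i : ℕ) : Measurable (fun x : ℕ → ℝ ↦ lagTerm σ k x i) := by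
  unfold lagTerm
  fun_prop

@[fun_prop]
lemma measurable_lagSum (σ : ℝ) (k m : ℕ) : Measurable (fun x : ℕ → ℝ ↦ lagSum σ k x m) := by
  unfold lagSum
  fun_prop

lemma abs_one_sub_sub_exp_neg_le {x : ℝ} (hx : 0 ≤ x) : |1 - x - Real.exp (-x)| ≤ x ^ 2 := by
  have h1 := Real.add_one_le_exp (-x)
  rw [abs_le]
  refine ⟨?_, by nlinarith [sq_nonneg x]⟩
  rcases le_total x 1 with h | h
  · have := (abs_le.1 (Real.abs_exp_sub_one_sub_id_le (x := -x)
      (by rwa [abs_neg, abs_of_nonneg hx]))).2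
    nlinarith
  · have : Real.exp (-x) ≤ 1 := Real.exp_le_one_iff.2 (by linarith)
    nlinarith

/-- Solving the approximate recursion `a (m + 1) ≈ q a m`. -/
lemma norm_sub_pow_le_of_norm_succ_sub_mul_le {a : ℕ → ℂ} {q β : ℝ} (hq0 : 0 ≤ q) (hq1 : q ≤ 1)
    (h0 : a 0 = 1) (h : ∀ m, ‖a (m + 1) - q * a m‖ ≤ β) (m : ℕ) :
    ‖a m - (q : ℂ) ^ m‖ ≤ m * β := by
  induction m with
  | zero => simp [h0]
  | succ m ih =>
    have e : a (m + 1) - (q : ℂ) ^ (m + 1) = (a (m + 1) - q * a m) + q * (a m - (q : ℂ) ^ m) := by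
      ring
    rw [e]
    refine (norm_add_le _ _).trans ?_
    rw [norm_mul, Complex.norm_real, Real.norm_of_nonneg hq0]
    have := mul_le_of_le_one_left (norm_nonneg (a m - (q : ℂ) ^ m)) hq1
    push_cast
    linarith [h m]

/-! ### Moments of the noise and of the increments -/

namespace IsIIDNoise

variable {Ω : Type*} [MeasurableSpace Ω] {P : Measure Ω} {ε : ℕ → Ω → ℝ} {σ : ℝ}

lemma aemeasurable (h : IsIIDNoise ε σ P) (i : ℕ) : AEMeasurable (ε i) P :=
  (h.ident i).aemeasurable_fst

lemma aemeasurable_pi (h : IsIIDNoise ε σ P) : AEMeasurable (fun ω i ↦ ε i ω) P :=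
  aemeasurable_pi_lambda _ h.aemeasurable

lemma memLp_four (h : IsIIDNoise ε σ P) (i : ℕ) : MemLp (ε i) 4 P :=
  (h.ident i).memLp_iff.2 h.memLp

lemma integral_comp (h : IsIIDNoise ε σ P) {f : ℝ → ℝ} (hf : Measurable f) (i : ℕ) :
    ∫ ω, f (ε i ω) ∂P = ∫ ω, f (ε 0 ω) ∂P :=
  ((h.ident i).comp hf).integral_eq

lemma integral_eq_zero (h : IsIIDNoise ε σ P) (i : ℕ) : ∫ ω, ε i ω ∂P = 0 :=
  (h.ident i).integral_eq.trans h.mean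

lemma integral_sq (h : IsIIDNoise ε σ P) (i : ℕ) : ∫ ω, ε i ω ^ 2 ∂P = σ ^ 2 :=
  (h.integral_comp (f := fun x ↦ x ^ 2) (by fun_prop) i).trans h.sq

lemma integral_pow_four (h : IsIIDNoise ε σ P) (i : ℕ) :
    ∫ ω, ε i ω ^ 4 ∂P = ∫ ω, ε 0 ω ^ 4 ∂P :=
  h.integral_comp (f := fun x ↦ x ^ 4) (by fun_prop) i

lemma integral_sq_sub_mul (h : IsIIDNoise ε σ P) (i : ℕ) :
    ∫ ω, (ε i ω ^ 2 - σ ^ 2) * ε i ω ∂P = ∫ ω, (ε 0 ω ^ 2 - σ ^ 2) * ε 0 ω ∂P :=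
  h.integral_comp (f := fun x ↦ (x ^ 2 - σ ^ 2) * x) (by fun_prop) i

/-- The centred part of the conditional variance of `lagTerm` given the past, as a function of
the value `x` of the noise at the earlier time. -/
noncomputable def condVarDev (ε : ℕ → Ω → ℝ) (σ : ℝ) (P : Measure Ω) (x : ℝ) : ℝ :=
  σ ^ 2 * (x ^ 2 - σ ^ 2) - 2 * (∫ ω, (ε 0 ω ^ 2 - σ ^ 2) * ε 0 ω ∂P) * x

lemma measurable_condVarDev : Measurable (condVarDev ε σ P) := by
  unfold condVarDev
  fun_prop

/-- The past up to time `m + k - 1` is independent of the noise at time `m + k`. -/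
lemma indepFun_lagSum {k : ℕ} (h : IsIIDNoise ε σ P) (hk : 1 ≤ k) (m : ℕ) (s : ℝ) :
    IndepFun (fun ω ↦ (Complex.exp ((s * lagSum σ k (fun j ↦ ε j ω) m : ℝ) * Complex.I), ε m ω))
      (ε (m + k)) P := by
  refine h.indep.indepFun_of_dependsOn h.aemeasurable
    (f := fun x ↦ (Complex.exp ((s * lagSum σ k x m : ℝ) * Complex.I), x m))
    (g := fun x ↦ x (m + k)) (s := Finset.range (m + k)) (t := {m + k})
    (by fun_prop) (by fun_prop) (by simp) ?_ ?_
  · intro x y hxy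
    have hS : lagSum σ k x m = lagSum σ k y m := Finset.sum_congr rfl fun i hi ↦ by
      rw [Finset.mem_range] at hi
      rw [lagTerm, lagTerm, hxy (i + k) (by simp; omega), hxy i (by simp; omega)]
    simp only [hS, hxy m (by simp; omega)]
  · intro x y hxy
    exact hxy _ (by simp)

variable [IsProbabilityMeasure P]

lemma memLp_two (h : IsIIDNoise ε σ P) (i : ℕ) : MemLp (ε i) 2 P :=
  (h.memLp_four i).mono_exponent (by norm_num)

lemma memLp_condVarDev (h : IsIIDNoise ε σ P) (i : ℕ) :
    MemLp (fun ω ↦ condVarDev ε σ P (ε i ω)) 2 P :=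
  ((memLp_sq_sub (h.memLp_four i)).const_mul _).sub ((h.memLp_two i).const_mul _)

lemma integral_condVarDev (h : IsIIDNoise ε σ P) (i : ℕ) :
    ∫ ω, condVarDev ε σ P (ε i ω) ∂P = 0 := by
  have i2 := (h.memLp_two i).integrable_sq
  have i1 : Integrable (ε i) P := (h.memLp_two i).integrable (by norm_num)
  have i3 : Integrable (fun ω ↦ ε i ω ^ 2 - σ ^ 2) P := i2.sub (integrable_const _)
  unfold condVarDev
  rw [integral_sub (i3.const_mul _) (i1.const_mul _),
    integral_const_mul, integral_const_mul, integral_sub i2 (integrable_const _), h.integral_sq,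
    h.integral_eq_zero]
  simp

section LagTerm

variable {k : ℕ}

lemma lagTerm_sq (h : IsIIDNoise ε σ P) (hk : 1 ≤ k) (i : ℕ) :
    MemLp (fun ω ↦ lagTerm σ k (fun j ↦ ε j ω) i) 2 P ∧
    ∫ ω, lagTerm σ k (fun j ↦ ε j ω) i ^ 2 ∂P = ∫ ω, ε 0 ω ^ 4 ∂P := by
  have hind : IndepFun (fun ω ↦ ((1 : ℂ), ε i ω)) (ε (i + k)) P :=
    (h.indep.indepFun (i := i) (j := i + k) (by omega)).comp
      (φ := fun x : ℝ ↦ ((1 : ℂ), x)) (ψ := id) (by fun_prop) measurable_id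
  obtain ⟨i1, e1⟩ := integral_mul_lag_sq (U := fun _ ↦ (1 : ℂ)) (by fun_prop) (by simp)
    hind (h.memLp_four _) (h.memLp_two _) (h.integral_sq _)
  have hm : AEStronglyMeasurable (fun ω ↦ lagTerm σ k (fun j ↦ ε j ω) i) P :=
    ((measurable_lagTerm σ k i).comp_aemeasurable h.aemeasurable_pi).aestronglyMeasurable
  simp only [one_mul] at i1 e1
  refine ⟨(memLp_two_iff_integrable_sq hm).2 ?_, ?_⟩
  · exact i1.re
  · rw [integral_complex_ofReal, integral_complex_ofReal, h.integral_sq_sub_mul] at e1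
    have := h.integral_condVarDev i
    unfold condVarDev at this
    rw [this, h.integral_pow_four] at e1
    unfold lagTerm
    simpa using e1

lemma identDistrib_lagTerm (h : IsIIDNoise ε σ P) (hk : 1 ≤ k) (i : ℕ) :
    IdentDistrib (fun ω ↦ lagTerm σ k (fun j ↦ ε j ω) i)
      (fun ω ↦ lagTerm σ 1 (fun j ↦ ε j ω) 0) P P := by
  have := IdentDistrib.prodMk ((h.ident (i + k)).trans (h.ident 1).symm) (h.ident i)
    (h.indep.indepFun (by omega)) (h.indep.indepFun (by omega))
  exact this.comp (u := fun p : ℝ × ℝ ↦ p.1 ^ 2 - σ ^ 2 - p.1 * p.2) (by fun_prop)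

/-! ### The recursion for the characteristic function -/

/-- Correlation of `exp (i s S_m)` with a centred function of the noise at time `m`: that noise
variable enters `S_m` only through the term with index `m - k`. -/
lemma norm_integral_exp_lagSum_mul_condVarDev_le (h : IsIIDNoise ε σ P) (hk : 1 ≤ k) (m : ℕ)
    (s : ℝ) :
    ‖∫ ω, Complex.exp ((s * lagSum σ k (fun j ↦ ε j ω) m : ℝ) * Complex.I)
        * (condVarDev ε σ P (ε m ω) : ℂ) ∂P‖ ≤
      |s| * ((∫ ω, ε 0 ω ^ 4 ∂P + ∫ ω, condVarDev ε σ P (ε 0 ω) ^ 2 ∂P) / 2) := by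
  let F : (ℕ → ℝ) → ℝ := fun x ↦ ∑ i ∈ Finset.range m with i + k ≠ m, lagTerm σ k x i
  have hF : Measurable F := by fun_prop
  have hlag : ∀ i, AEMeasurable (fun ω ↦ lagTerm σ k (fun j ↦ ε j ω) i) P := fun i ↦
    (measurable_lagTerm σ k i).comp_aemeasurable h.aemeasurable_pi
  have hind : IndepFun (fun ω ↦ F (fun j ↦ ε j ω)) (fun ω ↦ condVarDev ε σ P (ε m ω)) P := by
    refine h.indep.indepFun_of_dependsOn h.aemeasurable
      (f := F) (g := fun x ↦ condVarDev ε σ P (x m)) (s := (Finset.range (m + k)).erase m)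
      (t := {m}) hF (measurable_condVarDev.comp (measurable_pi_apply m)) (by simp) ?_ ?_
    · intro x y hxy
      refine Finset.sum_congr rfl fun i hi ↦ ?_
      rw [Finset.mem_filter, Finset.mem_range] at hi
      rw [lagTerm, lagTerm, hxy (i + k) (by simp; omega), hxy i (by simp; omega)]
    · intro x y hxy
      simp only [hxy m (by simp)]
  have hS : AEMeasurable (fun ω ↦ lagSum σ k (fun j ↦ ε j ω) m) P :=
    (measurable_lagSum σ k m).comp_aemeasurable h.aemeasurable_pi
  have hdiff : ∀ ω, |lagSum σ k (fun j ↦ ε j ω) m - F (fun j ↦ ε j ω)| ≤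
      |lagTerm σ k (fun j ↦ ε j ω) (m - k)| := fun ω ↦ by
    have e : lagSum σ k (fun j ↦ ε j ω) m = F (fun j ↦ ε j ω) +
        ∑ i ∈ Finset.range m with ¬ (i + k ≠ m), lagTerm σ k (fun j ↦ ε j ω) i :=
      (Finset.sum_filter_add_sum_filter_not _ _ _).symm
    rw [e, add_sub_cancel_left]
    rcases le_or_gt k m with hkm | hkm
    · have : (Finset.range m).filter (fun i ↦ ¬ (i + k ≠ m)) = {m - k} := by
        ext i
        simp
        omega
      rw [this, Finset.sum_singleton]
    · have : (Finset.range m).filter (fun i ↦ ¬ (i + k ≠ m)) = ∅ := by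
        ext i
        simp
        omega
      rw [this, Finset.sum_empty, abs_zero]
      exact abs_nonneg _
  have := norm_integral_exp_mul_le hS (hF.comp_aemeasurable h.aemeasurable_pi)
    (h.lagTerm_sq hk (m - k)).1 (h.memLp_condVarDev m) hind (h.integral_condVarDev m) hdiff s
  rwa [(h.lagTerm_sq hk (m - k)).2,
    h.integral_comp (f := fun x ↦ condVarDev ε σ P x ^ 2)
      (measurable_condVarDev.pow_const 2)] at this

/-- One step of the recursion for the characteristic function of `lagSum`. -/
lemma norm_integral_exp_lagSum_succ_sub_le (h : IsIIDNoise ε σ P) (hk : 1 ≤ k) (m : ℕ) (s : ℝ) :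
    ‖∫ ω, Complex.exp ((s * lagSum σ k (fun j ↦ ε j ω) (m + 1) : ℝ) * Complex.I) ∂P -
      (Real.exp (-(s ^ 2 * (∫ ω, ε 0 ω ^ 4 ∂P) / 2)) : ℝ) *
        ∫ ω, Complex.exp ((s * lagSum σ k (fun j ↦ ε j ω) m : ℝ) * Complex.I) ∂P‖ ≤
      ∫ ω, ‖expRemainder (s * lagTerm σ 1 (fun j ↦ ε j ω) 0)‖ ∂P +
      s ^ 2 / 2 * (|s| *
        ((∫ ω, ε 0 ω ^ 4 ∂P + ∫ ω, condVarDev ε σ P (ε 0 ω) ^ 2 ∂P) / 2)) +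
      (s ^ 2 * (∫ ω, ε 0 ω ^ 4 ∂P) / 2) ^ 2 := by
  set v := ∫ ω, ε 0 ω ^ 4 ∂P with hv
  have hv0 : 0 ≤ v := integral_nonneg fun ω ↦ by positivity
  set U : Ω → ℂ := fun ω ↦ Complex.exp ((s * lagSum σ k (fun j ↦ ε j ω) m : ℝ) * Complex.I) with hU
  set X : Ω → ℝ := fun ω ↦ lagTerm σ k (fun j ↦ ε j ω) m with hX
  have hUm : AEStronglyMeasurable U P := by
    have : Measurable fun x : ℕ → ℝ ↦ Complex.exp ((s * lagSum σ k x m : ℝ) * Complex.I) := by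
      fun_prop
    exact (this.comp_aemeasurable h.aemeasurable_pi).aestronglyMeasurable
  have hU1 : ∀ ω, ‖U ω‖ ≤ 1 := fun ω ↦ (Complex.norm_exp_ofReal_mul_I _).le
  have hUi : Integrable U P := by
    simpa using integrable_bounded_mul hUm hU1 (integrable_const (1 : ℝ))
  have hX2 := (h.lagTerm_sq hk m).1
  have hind := h.indepFun_lagSum hk m s
  have e1 : ∫ ω, U ω * (X ω : ℂ) ∂P = 0 := integral_mul_lag_eq_zero hUm hU1 hind (h.memLp_four _)
    (h.memLp_two _) (h.integral_eq_zero _) (h.integral_sq _)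
  have i1 := integrable_bounded_mul hUm hU1 (hX2.integrable (by norm_num))
  obtain ⟨i2, e2⟩ := integral_mul_lag_sq hUm hU1 hind (h.memLp_four _) (h.memLp_two _)
    (h.integral_sq _)
  rw [h.integral_pow_four, ← hv, h.integral_sq_sub_mul] at e2
  change Integrable (fun ω ↦ U ω * ((X ω ^ 2 : ℝ) : ℂ)) P at i2
  have hR : AEStronglyMeasurable (fun ω ↦ expRemainder (s * X ω)) P :=
    continuous_expRemainder.comp_aestronglyMeasurable (hX2.aestronglyMeasurable.const_mul s)
  have hRi : Integrable (fun ω ↦ expRemainder (s * X ω)) P := by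
    refine (hX2.integrable_sq.const_mul (4 * s ^ 2)).mono' hR (ae_of_all _ fun ω ↦ ?_)
    exact (norm_expRemainder_le_sq _).trans_eq (by ring)
  have i3 : Integrable (fun ω ↦ U ω * expRemainder (s * X ω)) P :=
    hRi.bdd_mul hUm (c := 1) (ae_of_all _ hU1)
  have hstep : ∀ ω, Complex.exp ((s * lagSum σ k (fun j ↦ ε j ω) (m + 1) : ℝ) * Complex.I) =
      U ω * expRemainder (s * X ω) + U ω + (s * Complex.I) * (U ω * (X ω : ℂ))
        - (s : ℂ) ^ 2 / 2 * (U ω * ((X ω ^ 2 : ℝ) : ℂ)) := fun ω ↦ by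
    have : (s * lagSum σ k (fun j ↦ ε j ω) (m + 1) : ℝ) * Complex.I =
        (s * lagSum σ k (fun j ↦ ε j ω) m : ℝ) * Complex.I + (s * X ω : ℝ) * Complex.I := by
      simp only [lagSum, Finset.sum_range_succ, hX]
      push_cast
      ring
    rw [this, Complex.exp_add, hU, expRemainder]
    push_cast
    ring
  have i31 : Integrable (fun ω ↦ U ω * expRemainder (s * X ω) + U ω) P := i3.add hUi
  have i32 : Integrable (fun ω ↦ U ω * expRemainder (s * X ω) + U ω
      + (s * Complex.I) * (U ω * (X ω : ℂ))) P := i31.add (i1.const_mul _)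
  simp_rw [hstep]
  rw [integral_sub i32 (i2.const_mul _), integral_add i31 (i1.const_mul _), integral_add i3 hUi,
    integral_const_mul, integral_const_mul, e1]
  have e2' : ∫ ω, U ω * ((X ω ^ 2 : ℝ) : ℂ) ∂P =
      v * ∫ ω, U ω ∂P + ∫ ω, U ω * (condVarDev ε σ P (ε m ω) : ℂ) ∂P := e2
  have hH := h.norm_integral_exp_lagSum_mul_condVarDev_le hk m s
  rw [← hv] at hH
  change ‖∫ ω, U ω * (condVarDev ε σ P (ε m ω) : ℂ) ∂P‖ ≤ _ at hH
  rw [e2']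
  set H := ∫ ω, U ω * (condVarDev ε σ P (ε m ω) : ℂ) ∂P
  set A := ∫ ω, U ω ∂P
  set T := ∫ ω, U ω * expRemainder (s * X ω) ∂P with hT
  have hTle : ‖T‖ ≤ ∫ ω, ‖expRemainder (s * lagTerm σ 1 (fun j ↦ ε j ω) 0)‖ ∂P := by
    have : ∫ ω, ‖expRemainder (s * X ω)‖ ∂P =
        ∫ ω, ‖expRemainder (s * lagTerm σ 1 (fun j ↦ ε j ω) 0)‖ ∂P :=
      ((h.identDistrib_lagTerm hk m).comp (u := fun x ↦ ‖expRemainder (s * x)‖)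
        (continuous_expRemainder.comp (continuous_const_mul s)).norm.measurable).integral_eq
    rw [← this]
    refine norm_integral_le_of_norm_le hRi.norm (ae_of_all _ fun ω ↦ ?_)
    rw [norm_mul]
    exact mul_le_of_le_one_left (norm_nonneg _) (hU1 ω)
  have hA : ‖A‖ ≤ 1 := by
    simpa using norm_integral_le_of_norm_le (integrable_const (1 : ℝ)) (ae_of_all P hU1)
  set q := Real.exp (-(s ^ 2 * v / 2))
  have e3 : T + A + s * Complex.I * 0 - (s : ℂ) ^ 2 / 2 * (v * A + H) - (q : ℂ) * A =
      T - ((s ^ 2 / 2 : ℝ) : ℂ) * H + ((1 - s ^ 2 * v / 2 - q : ℝ) : ℂ) * A := by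
    push_cast
    ring
  rw [e3]
  refine (norm_add_le _ _).trans (add_le_add ((norm_sub_le _ _).trans (add_le_add hTle ?_)) ?_)
  · rw [norm_mul, Complex.norm_real, Real.norm_of_nonneg (by positivity)]
    exact mul_le_mul_of_nonneg_left hH (by positivity)
  · rw [norm_mul, Complex.norm_real, Real.norm_eq_abs]
    exact (mul_le_of_le_one_right (abs_nonneg _) hA).trans
      (abs_one_sub_sub_exp_neg_le (by positivity))

end LagTerm

/-! ### The central limit theorem for the martingale part -/

/-- Along `s → 0` with `N s² → τ`, the characteristic functions of `lagSum` at `s` tend to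
the one of the Gaussian law with variance `E ε⁴`, evaluated at `√τ`. -/
lemma tendsto_integral_exp_lagSum (h : IsIIDNoise ε σ P) {k N : ℕ → ℕ} {s : ℕ → ℝ} {τ : ℝ}
    (hk : ∀ᶠ n in atTop, 1 ≤ k n) (hs : Tendsto s atTop (𝓝 0))
    (hN : Tendsto (fun n ↦ (N n : ℝ) * s n ^ 2) atTop (𝓝 τ)) :
    Tendsto (fun n ↦ ∫ ω, Complex.exp
        ((s n * lagSum σ (k n) (fun j ↦ ε j ω) (N n) : ℝ) * Complex.I) ∂P) atTop
      (𝓝 ((Real.exp (-(τ * (∫ ω, ε 0 ω ^ 4 ∂P) / 2)) : ℝ) : ℂ)) := by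
  set v := ∫ ω, ε 0 ω ^ 4 ∂P with hv
  have hv0 : 0 ≤ v := integral_nonneg fun ω ↦ by positivity
  set K := (v + ∫ ω, condVarDev ε σ P (ε 0 ω) ^ 2 ∂P) / 2 with hK
  set r : ℕ → ℝ := fun n ↦ ∫ ω, ‖expRemainder (s n * lagTerm σ 1 (fun j ↦ ε j ω) 0)‖ ∂P with hr
  have hlim : Tendsto (fun n ↦ ((Real.exp (-(N n * s n ^ 2 * v / 2)) : ℝ) : ℂ)) atTop
      (𝓝 ((Real.exp (-(τ * v / 2)) : ℝ) : ℂ)) :=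
    (Complex.continuous_ofReal.tendsto _).comp <| (Real.continuous_exp.tendsto _).comp
      ((hN.mul_const v).div_const 2).neg
  have hr0 : ∀ n, r n = s n ^ 2 * (r n / s n ^ 2) := fun n ↦ by
    rcases eq_or_ne (s n) 0 with h0 | h0
    · simp [hr, h0, expRemainder]
    · field_simp
  have hsmall : Tendsto (fun n ↦ (N n : ℝ) *
      (r n + s n ^ 2 / 2 * (|s n| * K) + (s n ^ 2 * v / 2) ^ 2)) atTop (𝓝 0) := by
    have h1 := tendsto_integral_norm_expRemainder_div_sq (h.lagTerm_sq le_rfl 0).1 hs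
    have h2 : Tendsto (fun n ↦ r n / s n ^ 2 + |s n| * K / 2 + s n ^ 2 * v ^ 2 / 4) atTop
        (𝓝 (0 + |0| * K / 2 + 0 ^ 2 * v ^ 2 / 4)) :=
      (h1.add ((hs.abs.mul_const K).div_const 2)).add (((hs.pow 2).mul_const _).div_const 4)
    have h3 := hN.mul h2
    simp only [abs_zero, zero_mul, zero_div, add_zero, ne_eq, OfNat.ofNat_ne_zero,
      not_false_eq_true, zero_pow, mul_zero] at h3
    refine h3.congr fun n ↦ ?_
    rw [hr0 n]
    generalize r n / s n ^ 2 = ρ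
    rcases eq_or_ne (s n) 0 with h0 | h0
    · simp [h0]
    · field_simp
      ring
  have hclose : Tendsto (fun n ↦ ∫ ω, Complex.exp
        ((s n * lagSum σ (k n) (fun j ↦ ε j ω) (N n) : ℝ) * Complex.I) ∂P -
      ((Real.exp (-(N n * s n ^ 2 * v / 2)) : ℝ) : ℂ)) atTop (𝓝 0) := by
    refine squeeze_zero_norm' ?_ hsmall
    filter_upwards [hk] with n hkn
    have := norm_sub_pow_le_of_norm_succ_sub_mul_le
      (a := fun m ↦ ∫ ω, Complex.exp
        ((s n * lagSum σ (k n) (fun j ↦ ε j ω) m : ℝ) * Complex.I) ∂P)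
      (q := Real.exp (-(s n ^ 2 * v / 2))) (Real.exp_pos _).le
      (Real.exp_le_one_iff.2 (neg_nonpos.2 (by positivity))) (by simp [lagSum])
      (fun m ↦ h.norm_integral_exp_lagSum_succ_sub_le hkn m (s n)) (N n)
    rw [← Complex.ofReal_pow, ← Real.exp_nat_mul,
      show (N n : ℝ) * -(s n ^ 2 * v / 2) = -(N n * s n ^ 2 * v / 2) by ring] at this
    exact this
  simpa using hclose.add hlim

/-- Central limit theorem for `lagSum`, with a lag that may vary with `n`. -/
lemma tendstoInDistribution_lagSum (h : IsIIDNoise ε σ P) {k N : ℕ → ℕ} {c : ℕ → ℝ}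
    (hk : ∀ᶠ n in atTop, 1 ≤ k n) (hc : Tendsto c atTop (𝓝 0))
    (hN : Tendsto (fun n ↦ (N n : ℝ) * c n ^ 2) atTop (𝓝 1)) :
    TendstoInDistribution (fun n ω ↦ c n * lagSum σ (k n) (fun j ↦ ε j ω) (N n)) atTop
      (fun x : ℝ ↦ x) (fun _ ↦ P) (gaussianReal 0 (Real.toNNReal (∫ ω, ε 0 ω ^ 4 ∂P))) where
  forall_aemeasurable n :=
    ((measurable_lagSum σ (k n) (N n)).comp_aemeasurable h.aemeasurable_pi).const_mul _
  tendsto := by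
    refine ProbabilityMeasure.tendsto_iff_tendsto_charFun.2 fun t ↦ ?_
    have hm : ∀ n, AEMeasurable (fun ω ↦ c n * lagSum σ (k n) (fun j ↦ ε j ω) (N n)) P := fun n ↦
      ((measurable_lagSum σ (k n) (N n)).comp_aemeasurable h.aemeasurable_pi).const_mul _
    have key := h.tendsto_integral_exp_lagSum (s := fun n ↦ t * c n) (τ := t ^ 2) hk
      (by simpa using hc.const_mul t)
      (by simpa using (hN.const_mul (t ^ 2)).congr fun n ↦ by ring)
    have hv0 : 0 ≤ ∫ ω, ε 0 ω ^ 4 ∂P := integral_nonneg fun ω ↦ by positivity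
    have hlim : charFun (Measure.map (fun x : ℝ ↦ x)
        (gaussianReal 0 (Real.toNNReal (∫ ω, ε 0 ω ^ 4 ∂P)))) t =
        ((Real.exp (-(t ^ 2 * (∫ ω, ε 0 ω ^ 4 ∂P) / 2)) : ℝ) : ℂ) := by
      rw [Measure.map_id', charFun_gaussianReal, Real.coe_toNNReal _ hv0]
      push_cast
      congr 1
      simp
      ring
    simp only [ProbabilityMeasure.coe_mk]
    rw [hlim]
    refine key.congr fun n ↦ ?_
    rw [charFun_apply_real, integral_map (hm n) (by fun_prop)]
    refine integral_congr_ae (ae_of_all _ fun ω ↦ ?_)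
    simp only
    push_cast
    congr 2
    ring

end IsIIDNoise

/-! ### Expansion of the estimator -/

lemma HasBoundedSecondDeriv.exists_lipschitz {g : ℝ → ℝ} (hg : HasBoundedSecondDeriv g) :
    ∃ L, ∀ x ∈ Set.Icc (0 : ℝ) 1, ∀ y ∈ Set.Icc (0 : ℝ) 1, |g y - g x| ≤ L * |y - x| := by
  obtain ⟨g', g'', C, h⟩ := hg
  obtain ⟨L, hL⟩ := isCompact_Icc.exists_bound_of_continuousOn
    (fun x hx ↦ (h x hx).2.1.continuousWithinAt : ContinuousOn g' (Set.Icc (0 : ℝ) 1))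
  exact ⟨L, fun x hx y hy ↦ (convex_Icc (0 : ℝ) 1).norm_image_sub_le_of_norm_hasDerivWithin_le
    (fun z hz ↦ (h z hz).1) hL hx hy⟩

lemma sum_Icc_one_eq_sum_range (f : ℕ → ℝ) (N : ℕ) :
    ∑ i ∈ Finset.Icc 1 N, f i = ∑ i ∈ Finset.range N, f (i + 1) := by
  induction N with
  | zero => simp
  | succ N ih => rw [Finset.sum_Icc_succ_top (by omega), ih, Finset.sum_range_succ]

lemma sum_range_shift_sub (f : ℕ → ℝ) (k N : ℕ) :
    ∑ i ∈ Finset.range N, (f (i + k) - f i) =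
      ∑ i ∈ Finset.range k, f (i + N) - ∑ i ∈ Finset.range k, f i := by
  have h1 := Finset.sum_range_add f k N
  have h2 := Finset.sum_range_add f N k
  rw [add_comm N k] at h2
  rw [Finset.sum_sub_distrib]
  simp_rw [add_comm _ k, add_comm _ N]
  linarith

/-- Expansion of the Rice estimator of the data `G + x`, where `G` is the deterministic part. -/
lemma lagRice_sub_sq {n k : ℕ} (hkn : k < n) (σ : ℝ) {y G x : ℕ → ℝ}
    (hy : ∀ i, y (i + 1) = G i + x i) {c : ℝ} (hc : c = Real.sqrt n / ((n - k : ℕ) : ℝ)) :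
    Real.sqrt n * (lagRice n k y - σ ^ 2) =
      c * lagSum σ k x (n - k)
      + ∑ i ∈ Finset.range (n - k), c * (G (i + k) - G i) * x (i + k)
      + ∑ i ∈ Finset.range (n - k), -(c * (G (i + k) - G i)) * x (i + 0)
      + ∑ i ∈ Finset.range k, -(c / 2) * (x (i + (n - k)) ^ 2 - σ ^ 2)
      + ∑ i ∈ Finset.range k, c / 2 * (x (i + 0) ^ 2 - σ ^ 2)
      + c / 2 * ∑ i ∈ Finset.range (n - k), (G (i + k) - G i) ^ 2 := by
  have hN : ((n - k : ℕ) : ℝ) = (n : ℝ) - k := Nat.cast_sub hkn.le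
  have hN0 : (0 : ℝ) < (n : ℝ) - k := by
    rw [sub_pos]
    exact_mod_cast hkn
  have hsq : ∑ i ∈ Finset.range (n - k), (y (i + 1 + k) - y (i + 1)) ^ 2 =
      2 * lagSum σ k x (n - k) + 2 * σ ^ 2 * ((n : ℝ) - k)
      - (∑ i ∈ Finset.range k, (x (i + (n - k)) ^ 2 - σ ^ 2)
        - ∑ i ∈ Finset.range k, (x i ^ 2 - σ ^ 2))
      + 2 * ∑ i ∈ Finset.range (n - k), (G (i + k) - G i) * x (i + k)
      - 2 * ∑ i ∈ Finset.range (n - k), (G (i + k) - G i) * x i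
      + ∑ i ∈ Finset.range (n - k), (G (i + k) - G i) ^ 2 := by
    have hconst : 2 * σ ^ 2 * ((n : ℝ) - k) = ∑ i ∈ Finset.range (n - k), 2 * σ ^ 2 := by
      rw [Finset.sum_const, Finset.card_range, nsmul_eq_mul, hN]
      ring
    rw [← sum_range_shift_sub (fun i ↦ x i ^ 2 - σ ^ 2), hconst, lagSum, Finset.mul_sum,
      Finset.mul_sum, Finset.mul_sum, ← Finset.sum_add_distrib, ← Finset.sum_sub_distrib,
      ← Finset.sum_add_distrib, ← Finset.sum_sub_distrib, ← Finset.sum_add_distrib]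
    refine Finset.sum_congr rfl fun i _ ↦ ?_
    rw [show i + 1 + k = i + k + 1 by ring, hy, hy, lagTerm]
    ring
  rw [lagRice, sum_Icc_one_eq_sum_range (fun i ↦ (y (i + k) - y i) ^ 2), hsq, hc, hN]
  simp_rw [mul_assoc, neg_mul, mul_assoc, Finset.sum_neg_distrib, ← Finset.mul_sum, add_zero]
  field_simp
  ring

/-! ### Negligible random terms -/

section Probability

variable {Ω : Type*} [MeasurableSpace Ω] {P : Measure Ω}

lemma IsIIDNoise.shift {ε : ℕ → Ω → ℝ} {σ : ℝ} (h : IsIIDNoise ε σ P) :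
    IsIIDNoise (fun i ↦ ε (i + 1)) σ P where
  indep := h.indep.precomp (add_left_injective 1)
  ident i := (h.ident (i + 1)).trans (h.ident 1).symm
  mean := h.integral_eq_zero 1
  sq := h.integral_comp (f := fun x ↦ x ^ 2) (by fun_prop) 1 |>.trans h.sq
  memLp := h.memLp_four 1

variable [IsProbabilityMeasure P]

/-- Chebyshev's inequality for weighted sums of centred independent variables: they vanish in
probability when the sum of the squared weights does. -/
lemma tendstoInMeasure_weighted_sum {ζ : ℕ → Ω → ℝ} (hindep : iIndepFun ζ P)
    (hident : ∀ i, IdentDistrib (ζ i) (ζ 0) P P) (hmean : ∫ ω, ζ 0 ω ∂P = 0)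
    (hL2 : MemLp (ζ 0) 2 P) {w : ℕ → ℕ → ℝ} {M j : ℕ → ℕ}
    (hw : Tendsto (fun n ↦ ∑ i ∈ Finset.range (M n), w n i ^ 2) atTop (𝓝 0)) :
    TendstoInMeasure P (fun n ω ↦ ∑ i ∈ Finset.range (M n), w n i * ζ (i + j n) ω) atTop
      (fun _ ↦ 0) := by
  have hζ : ∀ i, MemLp (ζ i) 2 P := fun i ↦ (hident i).memLp_iff.2 hL2
  have hterm : ∀ n i, MemLp (fun ω ↦ w n i * ζ (i + j n) ω) 2 P := fun n i ↦ (hζ _).const_mul _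
  have hsum : ∀ n, MemLp (fun ω ↦ ∑ i ∈ Finset.range (M n), w n i * ζ (i + j n) ω) 2 P :=
    fun n ↦ memLp_finsetSum _ fun i _ ↦ hterm n i
  have hE : ∀ n, ∫ ω, ∑ i ∈ Finset.range (M n), w n i * ζ (i + j n) ω ∂P = 0 := fun n ↦ by
    rw [integral_finsetSum _ fun i _ ↦ (hterm n i).integrable (by norm_num)]
    refine Finset.sum_eq_zero fun i _ ↦ ?_
    rw [integral_const_mul, (hident _).integral_eq, hmean, mul_zero]
  have hV : ∀ n, variance (fun ω ↦ ∑ i ∈ Finset.range (M n), w n i * ζ (i + j n) ω) P =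
      (∑ i ∈ Finset.range (M n), w n i ^ 2) * variance (ζ 0) P := fun n ↦ by
    have h := IndepFun.variance_sum (μ := P) (s := Finset.range (M n))
      (X := fun i ω ↦ w n i * ζ (i + j n) ω) (fun i _ ↦ hterm n i) (fun a _ b _ hab ↦ by
        exact (hindep.indepFun (i := a + j n) (j := b + j n) (by omega)).comp
          (φ := fun x ↦ w n a * x) (ψ := fun x ↦ w n b * x) (by fun_prop) (by fun_prop))
    have e : (∑ i ∈ Finset.range (M n), fun ω ↦ w n i * ζ (i + j n) ω) =
        fun ω ↦ ∑ i ∈ Finset.range (M n), w n i * ζ (i + j n) ω := by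
      ext ω
      simp
    rw [e] at h
    rw [h, Finset.sum_mul]
    refine Finset.sum_congr rfl fun i _ ↦ ?_
    rw [variance_const_mul, (hident _).variance_eq]
  refine tendstoInMeasure_iff_norm.2 fun δ hδ ↦ ?_
  have hlim : Tendsto (fun n ↦ ENNReal.ofReal
      ((∑ i ∈ Finset.range (M n), w n i ^ 2) * variance (ζ 0) P / δ ^ 2)) atTop (𝓝 0) := by
    have := ENNReal.tendsto_ofReal ((hw.mul_const (variance (ζ 0) P)).div_const (δ ^ 2))
    simpa using this
  refine tendsto_of_tendsto_of_tendsto_of_le_of_le tendsto_const_nhds hlim (fun _ ↦ zero_le)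
    fun n ↦ ?_
  have h := meas_ge_le_variance_div_sq (hsum n) hδ
  rw [hE n, hV n] at h
  simpa using h

lemma tendstoInMeasure_const_of_tendsto {a : ℕ → ℝ} (ha : Tendsto a atTop (𝓝 0)) :
    TendstoInMeasure P (fun n (_ : Ω) ↦ a n) atTop (fun _ ↦ 0) :=
  tendstoInMeasure_of_tendsto_ae (fun _ ↦ aestronglyMeasurable_const) (ae_of_all _ fun _ ↦ ha)

/-- Slutsky's theorem for a remainder that vanishes in probability. -/
lemma MeasureTheory.TendstoInDistribution.add_of_tendstoInMeasure_zero {X Y : ℕ → Ω → ℝ}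
    {μ : Measure ℝ} [IsProbabilityMeasure μ]
    (hX : TendstoInDistribution X atTop (fun x : ℝ ↦ x) (fun _ ↦ P) μ)
    (hY : TendstoInMeasure P Y atTop (fun _ ↦ 0)) (hYm : ∀ n, AEMeasurable (Y n) P) :
    TendstoInDistribution (fun n ω ↦ X n ω + Y n ω) atTop (fun x : ℝ ↦ x) (fun _ ↦ P) μ := by
  simpa [Pi.add_def] using hX.add_of_tendstoInMeasure_const hY hYm

/-- The central limit theorem for all terms in the expansion of the Rice estimator. The terms other
than `lagSum` are negligible as soon as the sums of their squared weights vanish. -/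
lemma IsIIDNoise.tendstoInDistribution_expansion {ξ : ℕ → Ω → ℝ} {σ : ℝ} (hξ : IsIIDNoise ξ σ P)
    {k N : ℕ → ℕ} {c b : ℕ → ℝ} {d : ℕ → ℕ → ℝ} (hk : ∀ᶠ n in atTop, 1 ≤ k n)
    (hc : Tendsto c atTop (𝓝 0)) (hN : Tendsto (fun n ↦ (N n : ℝ) * c n ^ 2) atTop (𝓝 1))
    (hcross : Tendsto (fun n ↦ ∑ i ∈ Finset.range (N n), (c n * d n i) ^ 2) atTop (𝓝 0))
    (hedge : Tendsto (fun n ↦ (k n : ℝ) * c n ^ 2) atTop (𝓝 0))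
    (hbias : Tendsto b atTop (𝓝 0)) :
    TendstoInDistribution (fun n ω ↦ c n * lagSum σ (k n) (fun j ↦ ξ j ω) (N n)
      + ∑ i ∈ Finset.range (N n), c n * d n i * ξ (i + k n) ω
      + ∑ i ∈ Finset.range (N n), -(c n * d n i) * ξ (i + 0) ω
      + ∑ i ∈ Finset.range (k n), -(c n / 2) * (ξ (i + N n) ω ^ 2 - σ ^ 2)
      + ∑ i ∈ Finset.range (k n), c n / 2 * (ξ (i + 0) ω ^ 2 - σ ^ 2)
      + b n) atTop (fun x : ℝ ↦ x) (fun _ ↦ P)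
      (gaussianReal 0 (Real.toNNReal (∫ ω, ξ 0 ω ^ 4 ∂P))) := by
  have hedge' : Tendsto (fun n ↦ ∑ i ∈ Finset.range (k n), (c n / 2) ^ 2) atTop (𝓝 0) := by
    have h := hedge.div_const 4
    simp only [zero_div] at h
    refine h.congr fun n ↦ ?_
    rw [Finset.sum_const, Finset.card_range, nsmul_eq_mul]
    ring
  let η : ℕ → Ω → ℝ := fun i ω ↦ ξ i ω ^ 2 - σ ^ 2
  have hηindep : iIndepFun η P := hξ.indep.comp (fun _ x ↦ x ^ 2 - σ ^ 2) (by fun_prop)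
  have hηident : ∀ i, IdentDistrib (η i) (η 0) P P := fun i ↦
    (hξ.ident i).comp (u := fun x ↦ x ^ 2 - σ ^ 2) (by fun_prop)
  have hηmean : ∫ ω, η 0 ω ∂P = 0 := by
    simp only [η]
    rw [integral_sub (hξ.memLp_two 0).integrable_sq (integrable_const _), hξ.sq]
    simp
  have hηL2 : MemLp (η 0) 2 P := memLp_sq_sub hξ.memLp
  have hξm : ∀ i, AEMeasurable (ξ i) P := hξ.aemeasurable
  have hηm : ∀ i, AEMeasurable (η i) P := fun i ↦ ((hξm i).pow_const 2).sub_const _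
  have hmeas : ∀ {ζ : ℕ → Ω → ℝ}, (∀ i, AEMeasurable (ζ i) P) → ∀ (M j : ℕ → ℕ) (w : ℕ → ℕ → ℝ) n,
      AEMeasurable (fun ω ↦ ∑ i ∈ Finset.range (M n), w n i * ζ (i + j n) ω) P :=
    fun hζ M j w n ↦ Finset.aemeasurable_fun_sum _ fun i _ ↦ (hζ _).const_mul _
  have t0 := hξ.tendstoInDistribution_lagSum hk hc hN
  have t1 := t0.add_of_tendstoInMeasure_zero
    (tendstoInMeasure_weighted_sum hξ.indep hξ.ident hξ.mean (hξ.memLp_two 0) (j := k) hcross)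
    (hmeas hξm _ _ _)
  have t2 := t1.add_of_tendstoInMeasure_zero
    (tendstoInMeasure_weighted_sum hξ.indep hξ.ident hξ.mean (hξ.memLp_two 0) (j := fun _ ↦ 0)
      (w := fun n i ↦ -(c n * d n i)) (by simpa only [neg_sq] using hcross))
    (hmeas hξm _ _ _)
  have t3 := t2.add_of_tendstoInMeasure_zero
    (tendstoInMeasure_weighted_sum hηindep hηident hηmean hηL2 (j := N)
      (w := fun n _ ↦ -(c n / 2)) (by simpa only [neg_sq] using hedge'))
    (hmeas hηm _ _ _)
  have t4 := t3.add_of_tendstoInMeasure_zero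
    (tendstoInMeasure_weighted_sum hηindep hηident hηmean hηL2 (j := fun _ ↦ 0)
      (w := fun n _ ↦ c n / 2) hedge')
    (hmeas hηm _ _ _)
  exact t4.add_of_tendstoInMeasure_zero (tendstoInMeasure_const_of_tendsto hbias)
    (fun _ ↦ aemeasurable_const)

end Probability

/-! ### Asymptotics of the lag -/

section Asymptotics

variable {r : ℝ} {k : ℕ → ℕ}

lemma natCast_le_two_mul_rpow (hr0 : 0 < r) (hk : ∀ n : ℕ, |(k n : ℝ) - (n : ℝ) ^ r| < 1) {n : ℕ}
    (hn : 1 ≤ n) : (k n : ℝ) ≤ 2 * (n : ℝ) ^ r := by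
  have h1 : (1 : ℝ) ≤ (n : ℝ) ^ r := Real.one_le_rpow (by exact_mod_cast hn) hr0.le
  linarith [(abs_lt.1 (hk n)).2]

lemma eventually_one_le_of_abs_sub_rpow_lt (hr0 : 0 < r)
    (hk : ∀ n : ℕ, |(k n : ℝ) - (n : ℝ) ^ r| < 1) : ∀ᶠ n in atTop, 1 ≤ k n := by
  filter_upwards [eventually_gt_atTop 1] with n hn
  have h1 : (1 : ℝ) < (n : ℝ) ^ r := Real.one_lt_rpow (by exact_mod_cast hn) hr0
  have h2 : (0 : ℝ) < k n := by linarith [(abs_lt.1 (hk n)).1]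
  exact_mod_cast h2

/-- The smoothing bias is of order `√n (k / n)²`; here `r < 3 / 4` is needed. -/
lemma tendsto_sqrt_mul_div_sq (hr0 : 0 < r) (hr1 : r < 3 / 4)
    (hk : ∀ n : ℕ, |(k n : ℝ) - (n : ℝ) ^ r| < 1) :
    Tendsto (fun n : ℕ ↦ Real.sqrt n * ((k n : ℝ) / n) ^ 2) atTop (𝓝 0) := by
  have h : Tendsto (fun n : ℕ ↦ 4 * (n : ℝ) ^ (-(3 / 2 - 2 * r))) atTop (𝓝 0) := by
    simpa using ((tendsto_rpow_neg_atTop (by linarith : 0 < 3 / 2 - 2 * r)).comp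
      tendsto_natCast_atTop_atTop).const_mul 4
  refine squeeze_zero' (Eventually.of_forall fun n ↦ by positivity) ?_ h
  filter_upwards [eventually_ge_atTop 1] with n hn
  have hn0 : (0 : ℝ) < n := by exact_mod_cast hn
  have h2 : ((k n : ℝ) / n) ^ 2 ≤ (2 * (n : ℝ) ^ r / n) ^ 2 := by
    gcongr
    exact natCast_le_two_mul_rpow hr0 hk hn
  refine (mul_le_mul_of_nonneg_left h2 (Real.sqrt_nonneg _)).trans_eq ?_
  rw [show -(3 / 2 - 2 * r) = 1 / 2 + (r + r) - 2 by ring, Real.rpow_sub hn0, Real.rpow_add hn0,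
    Real.rpow_add hn0, Real.sqrt_eq_rpow, Real.rpow_two]
  ring

lemma tendsto_div_zero_of_abs_sub_rpow_lt (hr0 : 0 < r) (hr1 : r < 3 / 4)
    (hk : ∀ n : ℕ, |(k n : ℝ) - (n : ℝ) ^ r| < 1) :
    Tendsto (fun n : ℕ ↦ (k n : ℝ) / n) atTop (𝓝 0) := by
  have h : Tendsto (fun n : ℕ ↦ 2 * (n : ℝ) ^ (-(1 - r))) atTop (𝓝 0) := by
    simpa using ((tendsto_rpow_neg_atTop (by linarith : 0 < 1 - r)).comp
      tendsto_natCast_atTop_atTop).const_mul 2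
  refine squeeze_zero' (Eventually.of_forall fun n ↦ by positivity) ?_ h
  filter_upwards [eventually_ge_atTop 1] with n hn
  have hn0 : (0 : ℝ) < n := by exact_mod_cast hn
  rw [show -(1 - r) = r - 1 by ring, Real.rpow_sub hn0, Real.rpow_one, ← mul_div_assoc]
  gcongr
  exact natCast_le_two_mul_rpow hr0 hk hn

lemma eventually_lt_of_tendsto_div_zero (h : Tendsto (fun n : ℕ ↦ (k n : ℝ) / n) atTop (𝓝 0)) :
    ∀ᶠ n in atTop, k n < n := by
  filter_upwards [h.eventually_lt_const one_pos, eventually_ge_atTop 1] with n hn h1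
  have hn0 : (0 : ℝ) < n := by exact_mod_cast h1
  rw [div_lt_one hn0] at hn
  exact_mod_cast hn

/-- With `N = n - k` and `c = √n / N`, `N c² = n / N → 1`. -/
lemma tendsto_sub_mul_sq (h : Tendsto (fun n : ℕ ↦ (k n : ℝ) / n) atTop (𝓝 0)) :
    Tendsto (fun n : ℕ ↦ ((n - k n : ℕ) : ℝ) * (Real.sqrt n / ((n - k n : ℕ) : ℝ)) ^ 2) atTop
      (𝓝 1) := by
  have h1 : Tendsto (fun n : ℕ ↦ (1 - (k n : ℝ) / n)⁻¹) atTop (𝓝 1) := by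
    simpa using (h.const_sub 1).inv₀ (by norm_num)
  refine h1.congr' ?_
  filter_upwards [eventually_lt_of_tendsto_div_zero h] with n hn
  have hN0 : (0 : ℝ) < (n : ℝ) - k n := by
    rw [sub_pos]
    exact_mod_cast hn
  have hn0 : (0 : ℝ) < n := by exact_mod_cast (by omega : 0 < n)
  rw [Nat.cast_sub hn.le, div_pow, Real.sq_sqrt hn0.le]
  field_simp

lemma tendsto_sqrt_div_sub (h : Tendsto (fun n : ℕ ↦ (k n : ℝ) / n) atTop (𝓝 0)) :
    Tendsto (fun n : ℕ ↦ Real.sqrt n / ((n - k n : ℕ) : ℝ)) atTop (𝓝 0) := by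
  have h1 : Tendsto (fun n : ℕ ↦ (1 - (k n : ℝ) / n)⁻¹ * (Real.sqrt n)⁻¹) atTop (𝓝 0) := by
    have := ((h.const_sub 1).inv₀ (by norm_num)).mul (tendsto_inv_atTop_zero.comp
      (Real.tendsto_sqrt_atTop.comp tendsto_natCast_atTop_atTop))
    simpa using this
  refine h1.congr' ?_
  filter_upwards [eventually_lt_of_tendsto_div_zero h] with n hn
  have hN0 : (0 : ℝ) < (n : ℝ) - k n := by
    rw [sub_pos]
    exact_mod_cast hn
  have hn0 : (0 : ℝ) < n := by exact_mod_cast (by omega : 0 < n)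
  have hs := Real.mul_self_sqrt hn0.le
  have hs0 := Real.sqrt_pos.2 hn0
  rw [Nat.cast_sub hn.le]
  field_simp
  nlinarith

/-- The boundary terms carry total squared weight `k c² → 0`. -/
lemma tendsto_mul_sq_zero (h : Tendsto (fun n : ℕ ↦ (k n : ℝ) / n) atTop (𝓝 0)) :
    Tendsto (fun n : ℕ ↦ (k n : ℝ) * (Real.sqrt n / ((n - k n : ℕ) : ℝ)) ^ 2) atTop (𝓝 0) := by
  have h1 := (h.mul (tendsto_sub_mul_sq h)).mul (tendsto_sub_mul_sq h)
  simp only [zero_mul] at h1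
  refine h1.congr' ?_
  filter_upwards [eventually_lt_of_tendsto_div_zero h] with n hn
  have hN0 : (0 : ℝ) < (n : ℝ) - k n := by
    rw [sub_pos]
    exact_mod_cast hn
  have hn0 : (0 : ℝ) < n := by exact_mod_cast (by omega : 0 < n)
  rw [Nat.cast_sub hn.le, div_pow, Real.sq_sqrt hn0.le]
  field_simp

variable {G : ℕ → ℕ → ℝ} {L : ℝ}

lemma sum_increments_sq_le {n k : ℕ} {G : ℕ → ℝ} {L : ℝ}
    (hG : ∀ i < n - k, |G (i + k) - G i| ≤ L * ((k : ℝ) / n)) :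
    ∑ i ∈ Finset.range (n - k), (G (i + k) - G i) ^ 2 ≤
      ((n - k : ℕ) : ℝ) * (L ^ 2 * ((k : ℝ) / n) ^ 2) := by
  have h : ∀ i ∈ Finset.range (n - k), (G (i + k) - G i) ^ 2 ≤ L ^ 2 * ((k : ℝ) / n) ^ 2 :=
    fun i hi ↦ by
      rw [← mul_pow, ← sq_abs (G (i + k) - G i)]
      exact pow_le_pow_left₀ (abs_nonneg _) (hG i (Finset.mem_range.1 hi)) 2
  simpa using Finset.sum_le_card_nsmul _ _ _ h

lemma tendsto_sum_weighted_increments_sq (hkn : Tendsto (fun n : ℕ ↦ (k n : ℝ) / n) atTop (𝓝 0))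
    (hG : ∀ᶠ n in atTop, ∀ i < n - k n, |G n (i + k n) - G n i| ≤ L * ((k n : ℝ) / n)) :
    Tendsto (fun n : ℕ ↦ ∑ i ∈ Finset.range (n - k n),
      (Real.sqrt n / ((n - k n : ℕ) : ℝ) * (G n (i + k n) - G n i)) ^ 2) atTop (𝓝 0) := by
  have h := (tendsto_sub_mul_sq hkn).mul ((hkn.pow 2).const_mul (L ^ 2))
  simp only [ne_eq, OfNat.ofNat_ne_zero, not_false_eq_true, zero_pow, mul_zero] at h
  refine squeeze_zero' (Eventually.of_forall fun n ↦ Finset.sum_nonneg fun i _ ↦ sq_nonneg _)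
    ?_ h
  filter_upwards [hG] with n hn
  simp_rw [mul_pow, ← Finset.mul_sum]
  refine (mul_le_mul_of_nonneg_left (sum_increments_sq_le hn) (sq_nonneg _)).trans_eq ?_
  ring

lemma tendsto_bias (hkn : Tendsto (fun n : ℕ ↦ (k n : ℝ) / n) atTop (𝓝 0))
    (hkn2 : Tendsto (fun n : ℕ ↦ Real.sqrt n * ((k n : ℝ) / n) ^ 2) atTop (𝓝 0))
    (hG : ∀ᶠ n in atTop, ∀ i < n - k n, |G n (i + k n) - G n i| ≤ L * ((k n : ℝ) / n)) :
    Tendsto (fun n : ℕ ↦ Real.sqrt n / ((n - k n : ℕ) : ℝ) / 2 *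
      ∑ i ∈ Finset.range (n - k n), (G n (i + k n) - G n i) ^ 2) atTop (𝓝 0) := by
  have h := hkn2.const_mul (L ^ 2 / 2)
  simp only [mul_zero] at h
  refine squeeze_zero' (Eventually.of_forall fun n ↦ by positivity) ?_ h
  filter_upwards [hG, eventually_lt_of_tendsto_div_zero hkn] with n hn hlt
  refine (mul_le_mul_of_nonneg_left (sum_increments_sq_le hn) (by positivity)).trans_eq ?_
  have hN0 : ((n - k n : ℕ) : ℝ) ≠ 0 := by exact_mod_cast (by omega : n - k n ≠ 0)
  generalize (k n : ℝ) / n = u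
  field_simp

end Asymptotics

/-! ### The limit law -/

theorem theorem1 {Ω : Type*} [MeasurableSpace Ω] (P : Measure Ω) [IsProbabilityMeasure P]
    (ε : ℕ → Ω → ℝ) (σ : ℝ) (hσ : 0 < σ)
    (hindep : iIndepFun ε P)
    (hident : ∀ i, IdentDistrib (ε i) (ε 0) P P)
    (hmean : ∫ ω, ε 0 ω ∂P = 0)
    (hvar : variance (ε 0) P = σ ^ 2)
    (hfour : MemLp (ε 0) 4 P)
    (g : ℝ → ℝ) (hg : HasBoundedSecondDeriv g)
    (r : ℝ) (hr0 : 0 < r) (hr1 : r < 3 / 4)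
    (k : ℕ → ℕ) (hk : ∀ n : ℕ, |(k n : ℝ) - (n : ℝ) ^ r| < 1) :
    TendstoInDistribution
      (fun (n : ℕ) (ω : Ω) ↦
        Real.sqrt (n : ℝ) * (lagRice n (k n) (fun i ↦ observation g ε n i ω) - σ ^ 2))
      atTop (fun x : ℝ ↦ x) (fun _ ↦ P)
      (gaussianReal 0 (Real.toNNReal (stdMoment (ε 0) σ P 4 * σ ^ 4))) := by
  have hε : IsIIDNoise ε σ P := by
    refine ⟨hindep, hident, hmean, ?_, hfour⟩
    rw [← hvar, variance_of_integral_eq_zero (hident 0).aemeasurable_fst hmean]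
  have hv : stdMoment (ε 0) σ P 4 * σ ^ 4 = ∫ ω, ε (0 + 1) ω ^ 4 ∂P := by
    rw [stdMoment, div_mul_cancel₀ _ (pow_ne_zero 4 hσ.ne')]
    exact (hε.integral_pow_four 1).symm
  rw [hv]
  have hkn := tendsto_div_zero_of_abs_sub_rpow_lt hr0 hr1 hk
  have hlt := eventually_lt_of_tendsto_div_zero hkn
  obtain ⟨L, hL⟩ := hg.exists_lipschitz
  -- the observations start at index `1`, whence the shift
  let G : ℕ → ℕ → ℝ := fun n i ↦ g (((i + 1 : ℕ) : ℝ) / n)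
  have hG : ∀ᶠ n in atTop, ∀ i < n - k n, |G n (i + k n) - G n i| ≤ L * ((k n : ℝ) / n) := by
    filter_upwards [hlt] with n hn i hi
    have hn0 : (0 : ℝ) < n := by exact_mod_cast (by omega : 0 < n)
    have hmem : ∀ j : ℕ, j ≤ n → (j : ℝ) / n ∈ Set.Icc (0 : ℝ) 1 := fun j hj ↦
      ⟨by positivity, (div_le_one hn0).2 (by exact_mod_cast hj)⟩
    have h := hL _ (hmem (i + 1) (by omega)) _ (hmem (i + k n + 1) (by omega))
    have e : ((i + k n + 1 : ℕ) : ℝ) / n - ((i + 1 : ℕ) : ℝ) / n = (k n : ℝ) / n := by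
      push_cast
      ring
    rwa [e, abs_of_nonneg (a := (k n : ℝ) / n) (by positivity)] at h
  have hclt := hε.shift.tendstoInDistribution_expansion
    (eventually_one_le_of_abs_sub_rpow_lt hr0 hk)
    (tendsto_sqrt_div_sub hkn) (tendsto_sub_mul_sq hkn)
    (tendsto_sum_weighted_increments_sq hkn hG) (tendsto_mul_sq_zero hkn)
    (tendsto_bias hkn (tendsto_sqrt_mul_div_sq hr0 hr1 hk) hG)
  -- the expansion of the estimator is valid once `k n < n`
  refine tendstoInDistribution_of_tendstoInMeasure_sub _ _ hclt
    (TendstoInMeasure.congr' ?_ (EventuallyEq.refl _ _)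
      (tendstoInMeasure_const_of_tendsto (a := fun _ ↦ 0) tendsto_const_nhds)) fun n ↦ ?_
  · filter_upwards [hlt] with n hn
    refine ae_of_all _ fun ω ↦ ?_
    have := lagRice_sub_sq hn σ (y := fun i ↦ observation g ε n i ω) (G := G n)
      (x := fun i ↦ ε (i + 1) ω) (fun i ↦ rfl) rfl
    rw [Pi.sub_apply, Pi.sub_apply, this, sub_self]
  · have hm : Measurable (fun y : ℕ → ℝ ↦
        Real.sqrt n * (lagRice n (k n) (fun i ↦ g ((i : ℝ) / n) + y i) - σ ^ 2)) := by
      unfold lagRice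
      fun_prop
    exact hm.comp_aemeasurable hε.aemeasurable_pi
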